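/- Let $A$ be a commutative noetherian ring. A complex of modules over a ring $R$ is called *perfect* if it is quasiisomorphic (i.e. isomorphic in the derived category of $R$-modules) to a finite complex $0 \to P^a \to \cdots \to P^b \to 0$ of finite (i.e. finitely generated) projective $R$-modules; such a finite complex is said to have *length* $b-a$. For an integer $r \ge 0$, the ring $R$ is *strongly $r$-regular* if every perfect complex over $R$ is quasiisomorphic to a finite direct sum of finite complexes of finite projective $R$-modules, each of length $\le r$. It is *strongly regular* if it is strongly $r$-regular for some $r \ge 0$. **Lemma 1.8.** For every integer $r \ge 0$ the following are equivalent: 1. $A$ is strongly $r$-regular. 2. For every prime ideal $\mathfrak p$ of $A$ the localization $A_{\mathfrak p}$ is strongly $r$-regular. 3. For every maximal ideal $\mathfrak m$ of $A$ the localization $A_{\mathfrak m}$ is strongly $r$-regular. Likewise, the following are equivalent: 1. $A$ is strongly regular. 2. For every prime ideal $\mathfrak p$ of $A$ the localization $A_{\mathfrak p}$ is strongly regular. 3. For every maximal ideal $\mathfrak m$ of $A$ the localization $A_{\mathfrak m}$ is strongly regular. (In the second list, the integer $r$ for which a localization is strongly $r$-regular may depend on the prime or maximal ideal.) -/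

import Mathlib

open CategoryTheory CategoryTheory.Limits

universe u

namespace StrongRegularity

instance hasFiniteBiproducts_cochainComplex (A : Type u) [Ring A] :
    HasFiniteBiproducts (CochainComplex (ModuleCat.{u} A) ℤ) :=
  HasFiniteBiproducts.of_hasFiniteCoproducts

/-- Two cochain complexes of `A`-modules are quasiisomorphic if they become isomorphic in the
derived category of `A`-modules. -/
def QuasiIsomorphic {A : Type u} [Ring A] (K L : CochainComplex (ModuleCat.{u} A) ℤ) : Prop :=
  letI := HasDerivedCategory.standard (ModuleCat.{u} A)
  Nonempty (DerivedCategory.Q.obj K ≅ DerivedCategory.Q.obj L)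

/-- `P` is a complex `0 → P^a → ⋯ → P^b → 0` of finite projective `A`-modules (placed in degrees
`a, …, b`, and zero in all other degrees). -/
structure IsFiniteProjectiveIn {A : Type u} [Ring A]
    (P : CochainComplex (ModuleCat.{u} A) ℤ) (a b : ℤ) : Prop where
  strictlyGE : P.IsStrictlyGE a
  strictlyLE : P.IsStrictlyLE b
  finite : ∀ i, Module.Finite A (P.X i)
  projective : ∀ i, Module.Projective A (P.X i)

/-- A perfect complex: a complex of `A`-modules quasiisomorphic to a finite complex of finite
projective `A`-modules. -/
def IsPerfect {A : Type u} [Ring A] (K : CochainComplex (ModuleCat.{u} A) ℤ) : Prop :=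
  ∃ (P : CochainComplex (ModuleCat.{u} A) ℤ) (a b : ℤ),
    IsFiniteProjectiveIn P a b ∧ QuasiIsomorphic K P

/-- A finite complex of finite projective modules `0 → P^a → ⋯ → P^b → 0` whose length `b - a`
is at most `r`. -/
def IsFiniteProjectiveOfLengthLE {A : Type u} [Ring A] (r : ℕ)
    (P : CochainComplex (ModuleCat.{u} A) ℤ) : Prop :=
  ∃ a b : ℤ, b - a ≤ r ∧ IsFiniteProjectiveIn P a b

/-- The ring `A` is strongly `r`-regular if every perfect complex over `A` is quasiisomorphic to a
(finite) direct sum of perfect complexes of length at most `r`. -/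
def IsStronglyRRegular (A : Type u) [Ring A] (r : ℕ) : Prop :=
  ∀ K : CochainComplex (ModuleCat.{u} A) ℤ, IsPerfect K →
    ∃ (s : ℕ) (F : Fin s → CochainComplex (ModuleCat.{u} A) ℤ),
      (∀ i, IsFiniteProjectiveOfLengthLE r (F i)) ∧ QuasiIsomorphic K (⨁ F)

/-- The ring `A` is strongly regular if it is strongly `r`-regular for some `r`. -/
def IsStronglyRegular (A : Type u) [Ring A] : Prop :=
  ∃ r : ℕ, IsStronglyRRegular A r

end StrongRegularity

/-! No complex is carried between `A` and its localizations. Instead, strong `r`-regularity of a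
noetherian ring is identified with a condition on local rings: for `r = 0` they are fields, for `r ≥
1` they are principal ideal domains. These conditions visibly agree for `A` and for its
localizations, and all `r ≥ 1` are equivalent.

Necessity (`IsStronglyRRegular.false_of_matrices`): take a complex `A² → ⋯ → A²` of length `r + 1`
whose matrices have entries in a prime `p`. If it is a sum of complexes of length at most `r`, the
identity is homotopic to a sum of endomorphisms, each zero in degree `0` or `r + 1`. When commuting
with the differentials forces "diagonal in `p`" to pass between neighbouring degrees, each of these
has diagonal in `p` in degree `0`; so does the homotopy term, whence `1 ∈ p`. Suitable matrices rule
out zero divisors, incomparable elements and, for `r = 0`, nonzero nonunits in the local ring.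

Sufficiency: over locally principal domains images of maps of finite projectives are projective, so
a complex splits into pieces `P^i/Z^i → Z^(i+1)`, with `Z` the cycles. Over local fields all finite
modules are projective, and a complex is homotopy equivalent to one with zero differential. -/

namespace StrongRegularity

/-! ### Morphisms out of K-projective complexes in the derived category -/

section DerivedCategory

variable {C : Type*} [Category* C] [Abelian C] [HasDerivedCategory C]
  {K L : CochainComplex C ℤ}

lemma exists_Q_map_eq [K.IsKProjective] (φ : DerivedCategory.Q.obj K ⟶ DerivedCategory.Q.obj L) :
    ∃ f : K ⟶ L, DerivedCategory.Q.map f = φ := by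
  obtain ⟨g, hg⟩ := (CochainComplex.IsKProjective.Qh_map_bijective K
    ((HomotopyCategory.quotient _ _).obj L)).surjective
    ((DerivedCategory.quotientCompQhIso C).hom.app K ≫ φ ≫
      (DerivedCategory.quotientCompQhIso C).inv.app L)
  obtain ⟨f, rfl⟩ := (HomotopyCategory.quotient C (.up ℤ)).map_surjective g
  refine ⟨f, ?_⟩
  have h := (DerivedCategory.quotientCompQhIso C).hom.naturality f
  simp only [Functor.comp_map, hg] at h
  rw [← cancel_epi ((DerivedCategory.quotientCompQhIso C).hom.app K), ← h]
  simp

lemma nonempty_homotopy_of_Q_map_eq [K.IsKProjective] {f g : K ⟶ L}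
    (h : DerivedCategory.Q.map f = DerivedCategory.Q.map g) : Nonempty (Homotopy f g) := by
  refine ⟨HomotopyCategory.homotopyOfEq _ _
    ((CochainComplex.IsKProjective.Qh_map_bijective K _).injective ?_)⟩
  have hf := (DerivedCategory.quotientCompQhIso C).hom.naturality f
  have hg := (DerivedCategory.quotientCompQhIso C).hom.naturality g
  rw [h, ← hg] at hf
  exact (cancel_mono _).1 hf

end DerivedCategory

lemma sum_f {C : Type*} [Category* C] [Preadditive C] {κ : Type*} {c : ComplexShape κ}
    {K L : HomologicalComplex C c} {ι : Type*} (s : Finset ι) (f : ι → (K ⟶ L)) (i : κ) :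
    (∑ j ∈ s, f j).f i = ∑ j ∈ s, (f j).f i :=
  map_sum (HomologicalComplex.Hom.fAddMonoidHom i) f s

section

variable {A : Type u} [CommRing A]

lemma QuasiIsomorphic.refl (K : CochainComplex (ModuleCat.{u} A) ℤ) : QuasiIsomorphic K K :=
  letI := HasDerivedCategory.standard (ModuleCat.{u} A)
  ⟨Iso.refl _⟩

lemma QuasiIsomorphic.trans {K L M : CochainComplex (ModuleCat.{u} A) ℤ}
    (h : QuasiIsomorphic K L) (h' : QuasiIsomorphic L M) : QuasiIsomorphic K M := by
  let := HasDerivedCategory.standard (ModuleCat.{u} A)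
  obtain ⟨e⟩ := h
  obtain ⟨e'⟩ := h'
  exact ⟨e ≪≫ e'⟩

lemma QuasiIsomorphic.of_homotopyEquiv {K L : CochainComplex (ModuleCat.{u} A) ℤ}
    (e : HomotopyEquiv K L) : QuasiIsomorphic K L := by
  let := HasDerivedCategory.standard (ModuleCat.{u} A)
  have : QuasiIso e.hom := inferInstance
  exact ⟨asIso (DerivedCategory.Q.map e.hom)⟩

lemma IsFiniteProjectiveIn.isKProjective {P : CochainComplex (ModuleCat.{u} A) ℤ} {a b : ℤ}
    (hP : IsFiniteProjectiveIn P a b) : P.IsKProjective := by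
  have := hP.strictlyLE
  have (n : ℤ) : Projective (P.X n) := by
    have := hP.projective n
    exact (IsProjective.iff_projective _).1 this
  exact CochainComplex.isKProjective_of_projective P b

/-- A decomposition of `K` as a direct sum in the derived category lifts to chain maps. -/
lemma exists_homotopy_sum_of_quasiIsomorphic {K : CochainComplex (ModuleCat.{u} A) ℤ}
    [K.IsKProjective] {s : ℕ} {F : Fin s → CochainComplex (ModuleCat.{u} A) ℤ}
    [∀ j, (F j).IsKProjective] (h : QuasiIsomorphic K (⨁ F)) :
    ∃ (f : ∀ j, K ⟶ F j) (g : ∀ j, F j ⟶ K), Nonempty (Homotopy (∑ j, f j ≫ g j) (𝟙 K)) := by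
  let := HasDerivedCategory.standard (ModuleCat.{u} A)
  obtain ⟨e⟩ := h
  choose f hf using fun j ↦ exists_Q_map_eq (e.hom ≫ DerivedCategory.Q.map (biproduct.π F j))
  choose g hg using fun j ↦ exists_Q_map_eq (DerivedCategory.Q.map (biproduct.ι F j) ≫ e.inv)
  refine ⟨f, g, nonempty_homotopy_of_Q_map_eq ?_⟩
  have h1 : ∑ j, DerivedCategory.Q.map (biproduct.π F j) ≫
      DerivedCategory.Q.map (biproduct.ι F j) = 𝟙 (DerivedCategory.Q.obj (⨁ F)) := by
    simp only [← Functor.map_comp, ← Functor.map_sum, biproduct.total]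
    exact CategoryTheory.Functor.map_id _ _
  calc DerivedCategory.Q.map (∑ j, f j ≫ g j)
      = e.hom ≫ (∑ j, DerivedCategory.Q.map (biproduct.π F j) ≫
          DerivedCategory.Q.map (biproduct.ι F j)) ≫ e.inv := by
        simp [Functor.map_sum, hf, hg, Preadditive.comp_sum, Preadditive.sum_comp]
    _ = DerivedCategory.Q.map (𝟙 K) := by
        rw [h1]; simp

/-! ### Complexes of free modules of rank two -/

/-- The functions `Fin 2 → A` if `0 ≤ i ≤ n`, and zero otherwise. -/
abbrev TwoX (A : Type u) (n : ℕ) (i : ℤ) : Type u := {_s : Fin 2 // 0 ≤ i ∧ i ≤ n} → A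

/-- Restriction of functions. -/
def twoRes (A : Type u) [CommRing A] (n : ℕ) (i : ℤ) : (Fin 2 → A) →ₗ[A] TwoX A n i :=
  LinearMap.funLeft A A Subtype.val

/-- Extension of functions by zero. -/
def twoExt (A : Type u) [CommRing A] (n : ℕ) (i : ℤ) : TwoX A n i →ₗ[A] (Fin 2 → A) where
  toFun v s := if h : 0 ≤ i ∧ i ≤ n then v ⟨s, h⟩ else 0
  map_add' v w := by ext s; by_cases h : 0 ≤ i ∧ i ≤ n <;> simp [h]
  map_smul' c v := by ext s; by_cases h : 0 ≤ i ∧ i ≤ n <;> simp [h]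

lemma twoRes_comp_twoExt (n : ℕ) (i : ℤ) : twoRes A n i ∘ₗ twoExt A n i = LinearMap.id := by
  refine LinearMap.ext fun v ↦ funext fun ⟨s, hs⟩ ↦ ?_
  simp [twoRes, twoExt, LinearMap.funLeft_apply, hs]

lemma twoExt_comp_twoRes {n : ℕ} {i : ℤ} (h : 0 ≤ i ∧ i ≤ n) :
    twoExt A n i ∘ₗ twoRes A n i = LinearMap.id := by
  refine LinearMap.ext fun v ↦ funext fun s ↦ ?_
  simp [twoRes, twoExt, LinearMap.funLeft_apply, h]

lemma twoExt_eq_zero {n : ℕ} {i : ℤ} (h : ¬ (0 ≤ i ∧ i ≤ n)) : twoExt A n i = 0 := by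
  refine LinearMap.ext fun v ↦ funext fun s ↦ ?_
  simp [twoExt, h]

/-- The differential given by a matrix `M`. -/
def twoD (n : ℕ) (i : ℤ) (M : Matrix (Fin 2) (Fin 2) A) : TwoX A n i →ₗ[A] TwoX A n (i + 1) :=
  twoRes A n (i + 1) ∘ₗ Matrix.toLin' M ∘ₗ twoExt A n i

lemma twoD_comp_twoD (n : ℕ) (i : ℤ) {M N : Matrix (Fin 2) (Fin 2) A} (h : N * M = 0) :
    twoD n (i + 1) N ∘ₗ twoD n i M = 0 := by
  by_cases hi : 0 ≤ i + 1 ∧ i + 1 ≤ n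
  · calc twoD n (i + 1) N ∘ₗ twoD n i M
        = twoRes A n (i + 1 + 1) ∘ₗ (Matrix.toLin' N ∘ₗ
            (twoExt A n (i + 1) ∘ₗ twoRes A n (i + 1)) ∘ₗ Matrix.toLin' M) ∘ₗ twoExt A n i := rfl
      _ = 0 := by
        rw [twoExt_comp_twoRes hi, LinearMap.id_comp, ← Matrix.toLin'_mul, h]; simp
  · simp [twoD, twoExt_eq_zero hi]

/-- The complex `A² → ⋯ → A²` in degrees `0, …, n` whose differentials are the matrices `D i`. -/
noncomputable def twoComplex (n : ℕ) (D : ℤ → Matrix (Fin 2) (Fin 2) A)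
    (hD : ∀ i, D (i + 1) * D i = 0) : CochainComplex (ModuleCat.{u} A) ℤ :=
  CochainComplex.of (fun i ↦ ModuleCat.of A (TwoX A n i)) (fun i ↦ ModuleCat.ofHom (twoD n i (D i)))
    (fun i ↦ by rw [← ModuleCat.ofHom_comp, twoD_comp_twoD _ _ (hD i)]; rfl)

lemma twoComplex_d (n : ℕ) (D : ℤ → Matrix (Fin 2) (Fin 2) A)
    (hD : ∀ i, D (i + 1) * D i = 0) (i : ℤ) :
    (twoComplex n D hD).d i (i + 1) = ModuleCat.ofHom (twoD n i (D i)) :=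
  CochainComplex.of_d (fun i ↦ ModuleCat.of A (TwoX A n i))
    (fun i ↦ ModuleCat.ofHom (twoD n i (D i))) i

lemma twoComplex_isFiniteProjectiveIn (n : ℕ) (D : ℤ → Matrix (Fin 2) (Fin 2) A)
    (hD : ∀ i, D (i + 1) * D i = 0) : IsFiniteProjectiveIn (twoComplex n D hD) 0 n := by
  have hz (i : ℤ) (hi : ¬ (0 ≤ i ∧ i ≤ n)) : IsZero ((twoComplex n D hD).X i) := by
    have : IsEmpty {_s : Fin 2 // 0 ≤ i ∧ i ≤ n} := ⟨fun s ↦ hi s.2⟩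
    have : Subsingleton (TwoX A n i) := inferInstance
    exact ModuleCat.isZero_of_subsingleton (ModuleCat.of A (TwoX A n i))
  refine ⟨?_, ?_, fun i ↦ ?_, fun i ↦ ?_⟩
  · rw [CochainComplex.isStrictlyGE_iff]
    exact fun i hi ↦ hz i (by omega)
  · rw [CochainComplex.isStrictlyLE_iff]
    exact fun i hi ↦ hz i (by omega)
  · exact inferInstanceAs (Module.Finite A (TwoX A n i))
  · exact inferInstanceAs (Module.Projective A (TwoX A n i))

section

variable {n : ℕ} {D : ℤ → Matrix (Fin 2) (Fin 2) A} {hD : ∀ i, D (i + 1) * D i = 0}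

/-- The matrix of a linear map between terms of `twoComplex`. -/
noncomputable def twoMatrix {i j : ℤ} (φ : (twoComplex n D hD).X i ⟶ (twoComplex n D hD).X j) :
    Matrix (Fin 2) (Fin 2) A :=
  LinearMap.toMatrix' (twoExt A n j ∘ₗ (φ.hom : TwoX A n i →ₗ[A] TwoX A n j) ∘ₗ twoRes A n i)

/-- Valid in all degrees, since restriction after extension by zero is always the identity; matrices
act on the left, hence the reversed order. -/
lemma twoMatrix_comp {i j k : ℤ} (φ : (twoComplex n D hD).X i ⟶ (twoComplex n D hD).X j)
    (ψ : (twoComplex n D hD).X j ⟶ (twoComplex n D hD).X k) :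
    twoMatrix (φ ≫ ψ) = twoMatrix ψ * twoMatrix φ := by
  rw [twoMatrix, twoMatrix, twoMatrix, ← LinearMap.toMatrix'_comp]
  congr 1
  refine LinearMap.ext fun v ↦ ?_
  have h : twoRes A n j (twoExt A n j (φ.hom (twoRes A n i v))) = φ.hom (twoRes A n i v) :=
    LinearMap.congr_fun (twoRes_comp_twoExt (A := A) n j) _
  exact congrArg (fun w ↦ twoExt A n k (ψ.hom w)) h.symm

lemma twoMatrix_add {i j : ℤ} (φ ψ : (twoComplex n D hD).X i ⟶ (twoComplex n D hD).X j) :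
    twoMatrix (φ + ψ) = twoMatrix φ + twoMatrix ψ := by
  rw [twoMatrix, twoMatrix, twoMatrix, ← map_add]
  congr 1
  refine LinearMap.ext fun v ↦ ?_
  exact map_add (twoExt A n j) _ _

lemma twoMatrix_zero {i j : ℤ} :
    twoMatrix (0 : (twoComplex n D hD).X i ⟶ (twoComplex n D hD).X j) = 0 := by
  have := twoMatrix_add (0 : (twoComplex n D hD).X i ⟶ (twoComplex n D hD).X j) 0
  simpa using this

lemma twoMatrix_sum {i j : ℤ} {ι : Type*} (s : Finset ι)
    (φ : ι → ((twoComplex n D hD).X i ⟶ (twoComplex n D hD).X j)) :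
    twoMatrix (∑ k ∈ s, φ k) = ∑ k ∈ s, twoMatrix (φ k) := by
  classical
  induction s using Finset.induction_on with
  | empty => simp [twoMatrix_zero]
  | insert a s ha ih => rw [Finset.sum_insert ha, Finset.sum_insert ha, twoMatrix_add, ih]

lemma twoMatrix_id {i : ℤ} (hi : 0 ≤ i ∧ i ≤ n) :
    twoMatrix (𝟙 ((twoComplex n D hD).X i)) = 1 := by
  rw [twoMatrix, ← LinearMap.toMatrix'_id, ← twoExt_comp_twoRes hi]
  rfl

lemma twoMatrix_d {i : ℤ} (hi : 0 ≤ i) (hi' : i < n) :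
    twoMatrix ((twoComplex n D hD).d i (i + 1)) = D i := by
  rw [twoComplex_d]
  calc LinearMap.toMatrix' (twoExt A n (i + 1) ∘ₗ twoD n i (D i) ∘ₗ twoRes A n i)
      = LinearMap.toMatrix' ((twoExt A n (i + 1) ∘ₗ twoRes A n (i + 1)) ∘ₗ Matrix.toLin' (D i) ∘ₗ
          (twoExt A n i ∘ₗ twoRes A n i)) := rfl
    _ = D i := by
      rw [twoExt_comp_twoRes (by omega), twoExt_comp_twoRes (by omega)]
      simp

/-- A complex of rank two free modules whose endomorphisms are rigid modulo a prime `p` is not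
a direct sum of shorter complexes. -/
theorem IsStronglyRRegular.false_of_matrices {r : ℕ} (hA : IsStronglyRRegular A r)
    (p : Ideal A) [p.IsPrime] (D : ℤ → Matrix (Fin 2) (Fin 2) A)
    (hD : ∀ i, D (i + 1) * D i = 0) (hp : ∀ i s t, D i s t ∈ p)
    (hE : ∀ (i : ℤ), 0 ≤ i → i ≤ r → ∀ E E' : Matrix (Fin 2) (Fin 2) A, E' * D i = D i * E →
      ((∀ s, E s s ∈ p) ↔ ∀ s, E' s s ∈ p)) : False := by
  have hC := twoComplex_isFiniteProjectiveIn (r + 1) D hD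
  obtain ⟨s, F, hF, hq⟩ := hA (twoComplex (r + 1) D hD) ⟨_, _, _, hC, QuasiIsomorphic.refl _⟩
  have := hC.isKProjective
  have (j : Fin s) : (F j).IsKProjective := by
    obtain ⟨_, _, _, h⟩ := hF j
    exact h.isKProjective
  obtain ⟨f, g, ⟨H⟩⟩ := exists_homotopy_sum_of_quasiIsomorphic hq
  have key (j : Fin s) : ∀ t, twoMatrix ((f j ≫ g j).f 0) t t ∈ p := by
    -- A chain map commutes with each `D i`, so `hE` links consecutive degrees from `0` to `r + 1`.
    have step (i : ℕ) (hi : i ≤ r + 1) : (∀ t, twoMatrix ((f j ≫ g j).f 0) t t ∈ p) ↔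
        ∀ t, twoMatrix ((f j ≫ g j).f i) t t ∈ p := by
      induction i with
      | zero => rfl
      | succ i ih =>
        rw [ih (by omega)]
        push_cast
        refine hE i (by omega) (by omega) _ _ ?_
        have h := congrArg twoMatrix ((f j ≫ g j).comm i (i + 1))
        rw [twoMatrix_comp, twoMatrix_comp, twoMatrix_d (by omega) (by push_cast; omega)] at h
        exact h.symm
    have hz (i : ℤ) (h : IsZero ((F j).X i)) : ∀ t, twoMatrix ((f j ≫ g j).f i) t t ∈ p := by
      intro t
      rw [HomologicalComplex.comp_f, h.eq_of_tgt ((f j).f i) 0, zero_comp, twoMatrix_zero]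
      simp
    obtain ⟨a, b, hab, h⟩ := hF j
    have := h.strictlyLE
    have := h.strictlyGE
    -- A complex of length at most `r` misses degree `0` or degree `r + 1`: if `a ≤ 0` then `b ≤ r`.
    by_cases ha : 0 < a
    · exact hz 0 ((F j).isZero_of_isStrictlyGE a 0 ha)
    · rw [step (r + 1) le_rfl]
      exact hz _ ((F j).isZero_of_isStrictlyLE b _ (by push_cast; omega))
  have h0 : twoMatrix ((∑ j, f j ≫ g j).f 0) 0 0 ∈ p := by
    rw [sum_f, twoMatrix_sum, Matrix.sum_apply]
    exact Ideal.sum_mem _ fun j _ ↦ key j 0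
  -- In degree `0` only the term `d ≫ h` of the homotopy survives, and its matrix is a multiple of
  -- `D 0`, with entries in `p`.
  have hc := H.comm 0
  rw [dNext_eq H.hom (show (ComplexShape.up ℤ).Rel 0 (0 + 1) from rfl),
    prevD_eq H.hom (show (ComplexShape.up ℤ).Rel (-1) 0 from rfl)] at hc
  have hd : (twoComplex (r + 1) D hD).d (-1) 0 = 0 := by
    have := hC.strictlyGE
    exact ((twoComplex (r + 1) D hD).isZero_of_isStrictlyGE 0 (-1) (by omega)).eq_of_src _ _
  rw [hc, hd, comp_zero, add_zero, twoMatrix_add, twoMatrix_comp,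
    twoMatrix_d le_rfl (by push_cast; omega), HomologicalComplex.id_f,
    twoMatrix_id ⟨le_rfl, by positivity⟩, Matrix.add_apply, Matrix.one_apply_eq,
    Matrix.mul_apply] at h0
  have h1 : (1 : A) ∈ p := by
    refine (Ideal.add_mem_iff_right p (Ideal.sum_mem _ fun t _ ↦ ?_)).1 h0
    exact Ideal.mul_mem_left _ _ (hp _ _ _)
  exact (Ideal.ne_top_iff_one p).1 ‹p.IsPrime›.ne_top h1

end

end

/-! ### Local rings of a strongly regular ring -/

section Localization

variable {A : Type u} [CommRing A] {r : ℕ}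

lemma mem_iff_not_isUnit_algebraMap (p : Ideal A) [p.IsPrime] (B : Type*) [CommRing B]
    [Algebra A B] [IsLocalization.AtPrime B p] (a : A) : a ∈ p ↔ ¬ IsUnit (algebraMap A B a) := by
  rw [IsLocalization.AtPrime.isUnit_to_map_iff B p, Ideal.mem_primeCompl_iff, not_not]

lemma exists_associated_algebraMap (p : Ideal A) [p.IsPrime] (B : Type*) [CommRing B]
    [Algebra A B] [IsLocalization.AtPrime B p] (b : B) : ∃ a : A, Associated b (algebraMap A B a) := by
  obtain ⟨⟨a, s⟩, h⟩ := IsLocalization.surj p.primeCompl b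
  exact ⟨a, (IsLocalization.map_units B s).unit, h⟩

lemma IsStronglyRRegular.isDomain_localization (hA : IsStronglyRRegular A r)
    (p : Ideal A) [p.IsPrime] (B : Type*) [CommRing B]
    [Algebra A B] [IsLocalization.AtPrime B p] : IsDomain B := by
  have : Nontrivial B := (IsLocalization.AtPrime.isLocalRing B p).toNontrivial
  have main (x y : A) (h : algebraMap A B x * algebraMap A B y = 0) :
      algebraMap A B x = 0 ∨ algebraMap A B y = 0 := by
    rw [← map_mul, IsLocalization.map_eq_zero_iff p.primeCompl] at h
    obtain ⟨t, ht⟩ := h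
    by_contra! hxy
    obtain ⟨hx, hy⟩ := hxy
    -- Multiplying `x` by `t` makes the product with `y` vanish already in `A`, as `D² = 0`
    -- requires.
    have htx : algebraMap A B (t * x) ≠ 0 := by
      rwa [map_mul, Ne, (IsLocalization.map_units B t).mul_right_eq_zero]
    generalize hz : (t : A) * x = z at htx
    have hzy : z * y = 0 := by rw [← ht, ← hz, mul_assoc]
    have hzy' : algebraMap A B z * algebraMap A B y = 0 := by rw [← map_mul, hzy, map_zero]
    have hzp : z ∈ p := (mem_iff_not_isUnit_algebraMap p B z).2 fun hu ↦
      hy (hu.mul_right_eq_zero.1 hzy')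
    have hyp : y ∈ p := (mem_iff_not_isUnit_algebraMap p B y).2 fun hu ↦
      htx (hu.mul_left_eq_zero.1 hzy')
    have cancel {w c d : A} (hw : algebraMap A B w ≠ 0) (h : c * w = w * d) : c ∈ p ↔ d ∈ p := by
      have : c - d ∈ p := (mem_iff_not_isUnit_algebraMap p B _).2 fun hu ↦ hw <| by
        rw [← hu.mul_right_eq_zero, ← map_mul, sub_mul, h, mul_comm w d, sub_self, map_zero]
      exact ⟨fun hc ↦ by simpa using sub_mem hc this, fun hd ↦ by simpa using add_mem this hd⟩
    -- The off-diagonal entries of `E' D = D E` show that the diagonals of `E` and `E'` agree modulo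
    -- `p` up to a swap.
    refine hA.false_of_matrices p (fun _ ↦ !![0, z; y, 0]) (fun _ ↦ ?_) (fun _ s t ↦ ?_)
      (fun _ _ _ E E' h ↦ ?_)
    · ext s t
      fin_cases s <;> fin_cases t <;> simp [hzy, mul_comm y z]
    · fin_cases s <;> fin_cases t <;> simp [hzp, hyp]
    · have h1 := congrFun (congrFun h 0) 1
      have h2 := congrFun (congrFun h 1) 0
      simp [Matrix.mul_apply, Fin.sum_univ_two] at h1 h2
      rw [Fin.forall_fin_two, Fin.forall_fin_two, cancel htx h1, cancel hy h2, and_comm]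
  have : NoZeroDivisors B := ⟨fun {b c} h ↦ by
    obtain ⟨x, hx⟩ := exists_associated_algebraMap p B b
    obtain ⟨y, hy⟩ := exists_associated_algebraMap p B c
    rw [hx.eq_zero_iff, hy.eq_zero_iff]
    exact main x y ((hx.mul_mul hy).eq_zero_iff.1 h)⟩
  exact NoZeroDivisors.to_isDomain B

lemma IsStronglyRRegular.valuationRing_localization (hA : IsStronglyRRegular A r)
    (p : Ideal A) [p.IsPrime] (B : Type*) [CommRing B]
    [Algebra A B] [IsLocalization.AtPrime B p] [IsDomain B] : ValuationRing B := by
  have main (x y : A) : algebraMap A B x ∣ algebraMap A B y ∨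
      algebraMap A B y ∣ algebraMap A B x := by
    by_contra! hxy
    obtain ⟨hx, hy⟩ := hxy
    have hx0 : algebraMap A B x ≠ 0 := fun h ↦ hy (h ▸ dvd_zero _)
    have hy0 : algebraMap A B y ≠ 0 := fun h ↦ hx (h ▸ dvd_zero _)
    have hxp : x ∈ p := (mem_iff_not_isUnit_algebraMap p B x).2 fun hu ↦ hx hu.dvd
    have hyp : y ∈ p := (mem_iff_not_isUnit_algebraMap p B y).2 fun hu ↦ hy hu.dvd
    have cancel {w a b : A} (hw : algebraMap A B w ≠ 0) (h : w * (a * x + b * y) = 0) :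
        a ∈ p ∧ b ∈ p := by
      have h' := congrArg (algebraMap A B) h
      simp only [map_mul, map_add, map_zero, mul_eq_zero, hw, false_or] at h'
      constructor
      · refine (mem_iff_not_isUnit_algebraMap p B _).2 fun hu ↦ hy ?_
        rw [← hu.dvd_mul_left, eq_neg_of_add_eq_zero_left h']
        exact (Dvd.intro_left _ rfl).neg_right
      · refine (mem_iff_not_isUnit_algebraMap p B _).2 fun hu ↦ hx ?_
        rw [← hu.dvd_mul_left, eq_neg_of_add_eq_zero_right h']
        exact (Dvd.intro_left _ rfl).neg_right
    have hmem {a b : A} (h : a - b ∈ p) : a ∈ p ↔ b ∈ p :=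
      ⟨fun hc ↦ by simpa using sub_mem hc h, fun hd ↦ by simpa using add_mem h hd⟩
    -- The column `(x, y)` times the row `(-y, x)`, which annihilate each other. A relation `a x + b
    -- y = 0` has coefficients in `p`, since neither element divides the other in `B`; again the
    -- diagonals are swapped modulo `p`.
    refine hA.false_of_matrices p (fun _ ↦ !![-(x * y), x * x; -(y * y), x * y]) (fun _ ↦ ?_)
      (fun _ s t ↦ ?_) (fun _ _ _ E E' h ↦ ?_)
    · ext s t
      fin_cases s <;> fin_cases t <;> simp <;> ring
    · fin_cases s <;> fin_cases t <;> simp [Ideal.mul_mem_left, hxp, hyp]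
    · have h1 := congrFun (congrFun h 0) 1
      have h2 := congrFun (congrFun h 1) 0
      simp [Matrix.mul_apply, Fin.sum_univ_two] at h1 h2
      have h3 : E' 0 0 - E 1 1 ∈ p :=
        (cancel (b := E' 0 1 + E 0 1) hx0 (by linear_combination h1)).1
      have h4 : E' 1 1 - E 0 0 ∈ p :=
        (cancel (a := E' 1 0 + E 1 0) hy0 (by linear_combination -h2)).2
      rw [Fin.forall_fin_two, Fin.forall_fin_two, hmem h3, hmem h4, and_comm]
  refine ValuationRing.iff_dvd_total.2 ⟨fun b c ↦ ?_⟩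
  obtain ⟨x, hx⟩ := exists_associated_algebraMap p B b
  obtain ⟨y, hy⟩ := exists_associated_algebraMap p B c
  rw [hx.dvd_iff_dvd_left, hy.dvd_iff_dvd_right, hy.dvd_iff_dvd_left, hx.dvd_iff_dvd_right]
  exact main x y

/-- The localizations of a strongly `r`-regular noetherian ring are discrete valuation rings or
fields. -/
theorem IsStronglyRRegular.isDomain_and_isPrincipalIdealRing_localization [IsNoetherianRing A]
    (hA : IsStronglyRRegular A r) (p : Ideal A) [p.IsPrime] (B : Type*) [CommRing B]
    [Algebra A B] [IsLocalization.AtPrime B p] :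
    IsDomain B ∧ IsPrincipalIdealRing B := by
  have := hA.isDomain_localization p B
  have := hA.valuationRing_localization p B
  have : IsNoetherianRing B := IsLocalization.isNoetherianRing p.primeCompl B inferInstance
  -- Finitely generated ideals of a valuation ring are principal, and here all ideals are finitely
  -- generated.
  exact ⟨inferInstance, inferInstance⟩

theorem IsStronglyRRegular.isField_localization (hA : IsStronglyRRegular A 0)
    (p : Ideal A) [p.IsPrime] (B : Type*) [CommRing B]
    [Algebra A B] [IsLocalization.AtPrime B p] : IsField B := by
  have := hA.isDomain_localization p B
  refine ⟨exists_pair_ne B, mul_comm, fun {b} hb ↦ ?_⟩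
  obtain ⟨x, hx⟩ := exists_associated_algebraMap p B b
  rw [Ne, hx.eq_zero_iff] at hb
  suffices IsUnit b by exact this.exists_right_inv
  rw [hx.isUnit_iff]
  by_contra hu
  have hxp := (mem_iff_not_isUnit_algebraMap p B x).2 hu
  -- For `r = 0` only the differential out of degree `0` matters, so `D² = 0` costs nothing and a
  -- single nonzero nonunit `x` suffices.
  refine hA.false_of_matrices p (fun i ↦ if i = 0 then Matrix.scalar _ x else 0) (fun i ↦ ?_)
      (fun i s t ↦ ?_) (fun i hi hi' E E' h ↦ ?_)
  · split_ifs
    · omega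
    all_goals simp
  · split_ifs
    · fin_cases s <;> fin_cases t <;> simp [hxp]
    · simp
  · obtain rfl : i = 0 := by simpa using le_antisymm hi' hi
    have key (s : Fin 2) : E' s s ∈ p ↔ E s s ∈ p := by
      have h1 := congrFun (congrFun h s) s
      simp at h1
      have : E' s s - E s s ∈ p := (mem_iff_not_isUnit_algebraMap p B _).2 fun hu' ↦ hb <| by
        rw [← hu'.mul_right_eq_zero, ← map_mul, sub_mul, h1, mul_comm x, sub_self, map_zero]
      exact ⟨fun hc ↦ by simpa using sub_mem hc this, fun hd ↦ by simpa using add_mem this hd⟩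
    simp [key]

end Localization

/-! ### Splitting complexes by idempotent chain maps -/

section Splitting

variable {A : Type u} [CommRing A] {P : CochainComplex (ModuleCat.{u} A) ℤ} {a b : ℤ}

lemma IsFiniteProjectiveIn.of_retract (hP : IsFiniteProjectiveIn P a b)
    {Y : CochainComplex (ModuleCat.{u} A) ℤ} (i : Y ⟶ P) (e : P ⟶ Y) (hie : i ≫ e = 𝟙 Y) {c d : ℤ}
    (hcd : ∀ k, k < c ∨ d < k → (e ≫ i).f k = 0) : IsFiniteProjectiveIn Y c d := by
  have hk (k : ℤ) : i.f k ≫ e.f k = 𝟙 (Y.X k) := by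
    rw [← HomologicalComplex.comp_f, hie, HomologicalComplex.id_f]
  have hz (k : ℤ) (h : k < c ∨ d < k) : IsZero (Y.X k) := by
    rw [IsZero.iff_id_eq_zero]
    calc 𝟙 (Y.X k) = (i.f k ≫ e.f k) ≫ (i.f k ≫ e.f k) := by simp [hk]
      _ = i.f k ≫ (e ≫ i).f k ≫ e.f k := by simp
      _ = 0 := by rw [hcd k h]; simp
  have hl (k : ℤ) : (e.f k).hom ∘ₗ (i.f k).hom = LinearMap.id := by
    rw [← ModuleCat.hom_comp, hk, ModuleCat.hom_id]
  refine ⟨?_, ?_, fun k ↦ ?_, fun k ↦ ?_⟩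
  · rw [CochainComplex.isStrictlyGE_iff]
    exact fun k h ↦ hz k (.inl h)
  · rw [CochainComplex.isStrictlyLE_iff]
    exact fun k h ↦ hz k (.inr h)
  · have := hP.finite k
    exact Module.Finite.of_surjective (e.f k).hom
      (fun y ↦ ⟨(i.f k).hom y, LinearMap.congr_fun (hl k) y⟩)
  · have := hP.projective k
    exact Module.Projective.of_split (i.f k).hom (e.f k).hom (hl k)

/-- A family of orthogonal idempotents whose sum is homotopic to the identity decomposes a
complex. -/
theorem IsFiniteProjectiveIn.exists_quasiIsomorphic_biproduct (hP : IsFiniteProjectiveIn P a b)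
    {r s : ℕ} (ε : Fin s → (P ⟶ P)) (hε : ∀ j, ε j ≫ ε j = ε j)
    (hε' : ∀ j k, j ≠ k → ε j ≫ ε k = 0) (H : Homotopy (∑ j, ε j) (𝟙 P))
    (hs : ∀ j, ∃ c d : ℤ, d - c ≤ r ∧ ∀ k, k < c ∨ d < k → (ε j).f k = 0) :
    ∃ F : Fin s → CochainComplex (ModuleCat.{u} A) ℤ,
      (∀ j, IsFiniteProjectiveOfLengthLE r (F j)) ∧ QuasiIsomorphic P (⨁ F) := by
  choose F i e hie hei using fun j ↦ IsIdempotentComplete.idempotents_split P (ε j) (hε j)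
  -- One composite is `∑ ε j`, homotopic to the identity; the other is the identity by
  -- orthogonality.
  refine ⟨F, fun j ↦ ?_, .of_homotopyEquiv
    ⟨biproduct.lift e, biproduct.desc i, .trans (.ofEq ?_) H, .ofEq ?_⟩⟩
  · obtain ⟨c, d, hcd, h⟩ := hs j
    exact ⟨c, d, hcd, hP.of_retract (i j) (e j) (hie j) (by rwa [hei])⟩
  · simp [biproduct.lift_desc, hei]
  · refine biproduct.hom_ext' _ _ fun j ↦ biproduct.hom_ext _ _ fun k ↦ ?_
    simp only [biproduct.ι_desc_assoc, Category.assoc, biproduct.lift_π, Category.comp_id]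
    by_cases h : j = k
    · subst h
      simp [hie]
    · rw [biproduct.ι_π_ne _ h]
      calc i j ≫ e k = (i j ≫ e j) ≫ i j ≫ e k ≫ (i k ≫ e k) := by simp [hie]
        _ = i j ≫ ((e j ≫ i j) ≫ (e k ≫ i k)) ≫ e k := by simp only [Category.assoc]
        _ = 0 := by rw [hei, hei, hε' j k h]; simp

lemma sum_ite_eq_add {M : Type*} [AddCommMonoid M] {c i : ℤ} {s : ℕ} (h : c ≤ i) (h' : i < c + s)
    (x : M) : ∑ j : Fin s, (if i = c + (j : ℕ) then x else 0) = x := by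
  rw [Finset.sum_eq_single (⟨(i - c).toNat, by omega⟩ : Fin s)]
  · rw [if_pos]
    simp only
    omega
  · intro j _ hj
    rw [if_neg]
    intro h
    apply hj
    ext
    simp only
    omega
  · simp

/-- If images of maps between finite projective modules are projective, every perfect complex
is a sum of complexes of length at most one. -/
theorem isStronglyRRegular_one_of_projective_range
    (hA : ∀ (M N : Type u) [AddCommGroup M] [AddCommGroup N] [Module A M] [Module A N]
      [Module.Finite A M] [Module.Finite A N] [Module.Projective A M] [Module.Projective A N]
      (f : M →ₗ[A] N), Module.Projective A (LinearMap.range f)) : IsStronglyRRegular A 1 := by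
  rintro K ⟨P, a, b, hP, hK⟩
  -- `e` projects onto the cycles, using a section of the differential onto its projective image.
  have exists_e (i : ℤ) : ∃ e : P.X i ⟶ P.X i, e ≫ e = e ∧ e ≫ P.d i (i + 1) = 0 ∧
      ∀ j, P.d j i ≫ e = P.d j i := by
    have := hP.finite
    have := hP.projective
    let f := (P.d i (i + 1)).hom
    have := hA _ _ f
    obtain ⟨g, hg⟩ := f.rangeRestrict.exists_rightInverse_of_surjective f.range_rangeRestrict
    have hg' (y) : f (g y) = y := congrArg Subtype.val (LinearMap.congr_fun hg y)
    have hf (x) : (P.d i (i + 1)).hom x = f x := rfl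
    refine ⟨ModuleCat.ofHom (LinearMap.id - g ∘ₗ f.rangeRestrict), ?_, ?_, fun j ↦ ?_⟩
    · ext x
      have : f.rangeRestrict (x - g (f.rangeRestrict x)) = 0 := by
        ext
        simp [hg']
      simp [this]
    · ext x
      simp [hf, hg']
    · ext x
      have : f.rangeRestrict ((P.d j i).hom x) = 0 := by
        ext
        exact LinearMap.congr_fun (congrArg ModuleCat.Hom.hom (P.d_comp_d j i (i + 1))) x
      simp [this]
  choose e hee hed hde using exists_e
  -- `ε k` cuts out the cycles in degree `k` and the complement of the cycles in degree `k - 1`.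
  let ε (k : ℤ) : P ⟶ P :=
    { f := fun i ↦ (if i = k then e i else 0) + (if i + 1 = k then 𝟙 _ - e i else 0)
      comm' := by
        rintro i j (rfl : i + 1 = j)
        by_cases h1 : i = k
        · subst h1
          simp [hed, show i + 1 + 1 ≠ i by omega]
        · by_cases h2 : i + 1 = k
          · subst h2
            simp [Preadditive.sub_comp, hed, hde]
          · by_cases h3 : i + 1 + 1 = k <;> simp [h1, h2, h3, Preadditive.comp_sub, hde] }
  -- The index runs from `a` to `b + 1`: the last piece takes the complement of the cycles in degree
  -- `b`.
  suffices H : ∃ F : Fin (b - a + 2).toNat → CochainComplex (ModuleCat.{u} A) ℤ,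
      (∀ j, IsFiniteProjectiveOfLengthLE 1 (F j)) ∧ QuasiIsomorphic P (⨁ F) by
    obtain ⟨F, hF, hF'⟩ := H
    exact ⟨_, F, hF, hK.trans hF'⟩
  refine hP.exists_quasiIsomorphic_biproduct
    (fun j ↦ ε (a + (j : ℕ))) (fun j ↦ ?_) (fun j k hjk ↦ ?_) (.ofEq ?_) (fun j ↦ ?_)
  · ext1 i
    dsimp [ε]
    split_ifs
    · omega
    all_goals simp [Preadditive.sub_comp, Preadditive.comp_sub, hee]
  · have hjk' : a + (j : ℕ) ≠ a + (k : ℕ) := by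
      intro h
      apply hjk
      ext
      omega
    ext1 i
    dsimp [ε]
    split_ifs <;> first | omega | simp [Preadditive.sub_comp, Preadditive.comp_sub, hee]
  · ext1 i
    rw [sum_f, HomologicalComplex.id_f]
    by_cases hi : a ≤ i ∧ i ≤ b
    · simp only [ε, Finset.sum_add_distrib]
      rw [sum_ite_eq_add (by omega) (by omega), sum_ite_eq_add (by omega) (by omega)]
      abel
    · have := hP.strictlyGE
      have := hP.strictlyLE
      have hz : IsZero (P.X i) := by
        by_cases h : i < a
        · exact P.isZero_of_isStrictlyGE a i h
        · exact P.isZero_of_isStrictlyLE b i (by omega)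
      exact hz.eq_of_src _ _
  · refine ⟨a + (j : ℕ) - 1, a + (j : ℕ), by simp, fun k hk ↦ ?_⟩
    dsimp [ε]
    rw [if_neg (by omega), if_neg (by omega), add_zero]

/-- If maps between finite projective modules have generalized inverses, every perfect complex
is a sum of complexes concentrated in one degree. -/
theorem isStronglyRRegular_zero_of_exists_generalizedInverse
    (hA : ∀ (M N : Type u) [AddCommGroup M] [AddCommGroup N] [Module A M] [Module A N]
      [Module.Finite A M] [Module.Finite A N] [Module.Projective A M] [Module.Projective A N]
      (f : M →ₗ[A] N), ∃ t : N →ₗ[A] M, f ∘ₗ t ∘ₗ f = f) : IsStronglyRRegular A 0 := by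
  rintro K ⟨P, a, b, hP, hK⟩
  have exists_t (i j : ℤ) : ∃ t : P.X j ⟶ P.X i, P.d i j ≫ t ≫ P.d i j = P.d i j := by
    have := hP.finite
    have := hP.projective
    obtain ⟨t, ht⟩ := hA _ _ (P.d i j).hom
    exact ⟨ModuleCat.ofHom t, by ext1; exact ht⟩
  choose t ht using exists_t
  have exists_h : ∃ h : ∀ i j, P.X i ⟶ P.X j, (∀ i j k, h i j ≫ h j k = 0) ∧
      (∀ i j, i + 1 = j → P.d i j ≫ h j i ≫ P.d i j = P.d i j) ∧
      (∀ i j, i + 1 = j → h j i ≫ P.d i j ≫ h j i = h j i) := by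
    -- `w i` is idempotent with the same kernel as the differential. Trimming `t` by `1 - w` and `w`
    -- yields a homotopy with `h² = 0`, `dhd = d` and `hdh = h`.
    let w (i : ℤ) : P.X i ⟶ P.X i := P.d i (i + 1) ≫ t i (i + 1)
    have hw (i) : w i ≫ w i = w i := by simp [w, reassoc_of% ht]
    have hdw (i j) : P.d i j ≫ w j = 0 := by simp [w]
    have hwd (i j) (h : i + 1 = j) : w i ≫ P.d i j = P.d i j := by
      subst h
      simp [w, ht]
    refine ⟨fun i j ↦ (𝟙 _ - w i) ≫ t j i ≫ w j, fun i j k ↦ ?_, fun i j hij ↦ ?_,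
      fun i j hij ↦ ?_⟩
    · simp [Preadditive.sub_comp, Preadditive.comp_sub, reassoc_of% hw]
    · simp only [Category.assoc, hwd i j hij, Preadditive.sub_comp, Preadditive.comp_sub,
        Category.id_comp, ht, reassoc_of% hdw, zero_comp, sub_zero]
    · have : P.d i j ≫ (𝟙 _ - w j) ≫ t i j ≫ w i = w i := by
        simp only [Preadditive.sub_comp, Preadditive.comp_sub,
          Category.id_comp, reassoc_of% hdw, zero_comp, sub_zero]
        subst hij
        rw [← Category.assoc]
        exact hw i
      rw [this]
      simp [hw]
  obtain ⟨h, hh, hdh, hhd⟩ := exists_h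
  let n : P ⟶ P := Homotopy.nullHomotopicMap' (fun i j _ ↦ h i j)
  -- `q = 1 - (dh + hd)` is homotopic to the identity, idempotent, and kills the differential on
  -- both sides, so its components in single degrees are chain maps.
  let q : P ⟶ P := 𝟙 P - n
  have Hq : Homotopy q (𝟙 P) := (Homotopy.equivSubZero.symm
    ((Homotopy.ofEq (sub_sub_cancel (𝟙 P) n)).trans (Homotopy.nullHomotopy' _))).symm
  have hq (i j k : ℤ) (hij : i + 1 = j) (hjk : j + 1 = k) :
      q.f j = 𝟙 _ - (P.d j k ≫ h k j + h j i ≫ P.d i j) := by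
    simp only [q, n, HomologicalComplex.sub_f_apply, HomologicalComplex.id_f]
    rw [Homotopy.nullHomotopicMap'_f (k₂ := i) (k₁ := j) (k₀ := k) hij hjk]
  have hqd (i j : ℤ) (hij : i + 1 = j) : q.f i ≫ P.d i j = 0 := by
    rw [hq (i - 1) i j (by omega) hij]
    simp [Preadditive.sub_comp, hdh i j hij]
  have hdq (i j : ℤ) (hij : i + 1 = j) : P.d i j ≫ q.f j = 0 := by
    rw [hq i j (j + 1) hij rfl]
    simp [Preadditive.comp_sub, hdh i j hij]
  have hqh (i j : ℤ) (hij : i + 1 = j) : q.f j ≫ h j i = 0 := by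
    rw [hq i j (j + 1) hij rfl]
    simp [Preadditive.sub_comp, hh, hhd i j hij]
  have hqq (j : ℤ) : q.f j ≫ q.f j = q.f j := by
    nth_rw 2 [hq (j - 1) j (j + 1) (by omega) rfl]
    simp [Preadditive.comp_sub, reassoc_of% hqd j (j + 1) rfl,
      reassoc_of% hqh (j - 1) j (by omega)]
  let ε (k : ℤ) : P ⟶ P :=
    { f := fun i ↦ if i = k then q.f i else 0
      comm' := by
        rintro i j (hij : i + 1 = j)
        split_ifs <;> simp [hqd i j hij, hdq i j hij] }
  suffices H : ∃ F : Fin (b - a + 1).toNat → CochainComplex (ModuleCat.{u} A) ℤ,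
      (∀ j, IsFiniteProjectiveOfLengthLE 0 (F j)) ∧ QuasiIsomorphic P (⨁ F) by
    obtain ⟨F, hF, hF'⟩ := H
    exact ⟨_, F, hF, hK.trans hF'⟩
  refine hP.exists_quasiIsomorphic_biproduct
    (fun j ↦ ε (a + (j : ℕ))) (fun j ↦ ?_) (fun j k hjk ↦ ?_) (.trans (.ofEq ?_) Hq) (fun j ↦ ?_)
  · ext1 i
    dsimp [ε]
    split_ifs <;> simp [hqq]
  · have hjk' : a + (j : ℕ) ≠ a + (k : ℕ) := by
      intro h
      apply hjk
      ext
      omega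
    ext1 i
    dsimp [ε]
    split_ifs <;> first | omega | simp
  · ext1 i
    rw [sum_f]
    by_cases hi : a ≤ i ∧ i ≤ b
    · exact sum_ite_eq_add (by omega) (by omega) _
    · have := hP.strictlyGE
      have := hP.strictlyLE
      have hz : IsZero (P.X i) := by
        by_cases h : i < a
        · exact P.isZero_of_isStrictlyGE a i h
        · exact P.isZero_of_isStrictlyLE b i (by omega)
      exact hz.eq_of_src _ _
  · refine ⟨a + (j : ℕ), a + (j : ℕ), by simp, fun k hk ↦ ?_⟩
    dsimp [ε]
    rw [if_neg (by omega)]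

end Splitting

/-! ### Between the ring and its localizations -/

lemma IsStronglyRRegular.mono {A : Type u} [CommRing A] {r s : ℕ} (hrs : r ≤ s)
    (hA : IsStronglyRRegular A r) : IsStronglyRRegular A s := by
  intro K hK
  obtain ⟨n, F, hF, h⟩ := hA K hK
  refine ⟨n, F, fun j ↦ ?_, h⟩
  obtain ⟨a, b, hab, hj⟩ := hF j
  exact ⟨a, b, by omega, hj⟩

section

variable {A : Type u} [CommRing A]

/-- A submodule of a projective module is torsion-free, and finite torsion-free modules over a
principal ideal domain are free. -/
lemma projective_of_injective {B M N : Type*} [CommRing B] [IsDomain B]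
    [IsPrincipalIdealRing B] [AddCommGroup M] [AddCommGroup N] [Module B M] [Module B N]
    [Module.Finite B M] [Module.Projective B N] (f : M →ₗ[B] N) (hf : Function.Injective f) :
    Module.Projective B M := by
  have : Module.IsTorsionFree B M := hf.moduleIsTorsionFree f (fun r x ↦ map_smul f r x)
  infer_instance

/-- A noetherian ring whose localizations at maximal ideals are principal ideal domains is
strongly `1`-regular. -/
theorem isStronglyRRegular_one_of_localization [IsNoetherianRing A]
    (h : ∀ (m : Ideal A) [m.IsMaximal], IsDomain (Localization.AtPrime m) ∧
      IsPrincipalIdealRing (Localization.AtPrime m)) : IsStronglyRRegular A 1 := by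
  refine isStronglyRRegular_one_of_projective_range fun M N _ _ _ _ _ _ _ _ f ↦ ?_
  -- Finite presentation is what makes projectivity a local property.
  have := Module.finitePresentation_of_finite A (LinearMap.range f)
  refine Module.projective_of_localization_maximal fun m hm ↦ ?_
  obtain ⟨_, _⟩ := h m
  exact projective_of_injective
    (LocalizedModule.map m.primeCompl (LinearMap.range f).subtype)
    (LocalizedModule.map_injective _ _ (Submodule.injective_subtype _))

/-- A ring all of whose finite modules are projective is strongly `0`-regular. -/
theorem isStronglyRRegular_zero_of_projective
    (hproj : ∀ (M : Type u) [AddCommGroup M] [Module A M] [Module.Finite A M],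
      Module.Projective A M) : IsStronglyRRegular A 0 := by
  refine isStronglyRRegular_zero_of_exists_generalizedInverse fun M N _ _ _ _ _ _ _ _ f ↦ ?_
  have := hproj (LinearMap.range f)
  have := hproj (N ⧸ LinearMap.range f)
  obtain ⟨g, hg⟩ := f.rangeRestrict.exists_rightInverse_of_surjective f.range_rangeRestrict
  obtain ⟨σ, hσ⟩ := (LinearMap.range f).mkQ.exists_rightInverse_of_surjective
    (Submodule.range_mkQ _)
  have hσ' (y) : (LinearMap.range f).mkQ (σ y) = y := LinearMap.congr_fun hσ y
  -- The retraction of `N` onto the image given by splitting the cokernel; followed by a section of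
  -- `f`, it is a generalized inverse.
  let ρ : N →ₗ[A] LinearMap.range f :=
    LinearMap.codRestrict _ (LinearMap.id - σ ∘ₗ (LinearMap.range f).mkQ) fun x ↦ by
      refine (Submodule.Quotient.mk_eq_zero _).1 ?_
      rw [← Submodule.mkQ_apply, LinearMap.sub_apply, map_sub, LinearMap.comp_apply, hσ',
        LinearMap.id_apply, sub_self]
  refine ⟨g ∘ₗ ρ, LinearMap.ext fun x ↦ ?_⟩
  have h1 : f (g (ρ (f x))) = ρ (f x) := congrArg Subtype.val (LinearMap.congr_fun hg (ρ (f x)))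
  have h2 : (LinearMap.range f).mkQ (f x) = 0 := by
    simp
  calc f (g (ρ (f x))) = f x - σ ((LinearMap.range f).mkQ (f x)) := h1
    _ = f x := by rw [h2, map_zero, sub_zero]

/-- A noetherian ring whose localizations at maximal ideals are fields is strongly
`0`-regular. -/
theorem isStronglyRRegular_zero_of_localization [IsNoetherianRing A]
    (h : ∀ (m : Ideal A) [m.IsMaximal], IsField (Localization.AtPrime m)) :
    IsStronglyRRegular A 0 := by
  refine isStronglyRRegular_zero_of_projective fun M _ _ _ ↦ ?_
  have := Module.finitePresentation_of_finite A M
  refine Module.projective_of_localization_maximal fun m hm ↦ ?_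
  let := (h m).toField
  infer_instance

/-- A principal ideal domain is strongly `1`-regular. -/
theorem isStronglyRRegular_one_of_isPrincipalIdealRing [IsDomain A] [IsPrincipalIdealRing A] :
    IsStronglyRRegular A 1 :=
  isStronglyRRegular_one_of_projective_range fun _ _ _ _ _ _ _ _ _ _ f ↦
    projective_of_injective (LinearMap.range f).subtype
      (Submodule.injective_subtype _)

/-- A field is strongly `0`-regular. -/
theorem isStronglyRRegular_zero_of_isField (h : IsField A) : IsStronglyRRegular A 0 := by
  refine isStronglyRRegular_zero_of_projective fun M _ _ _ ↦ ?_
  let := h.toField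
  infer_instance

/-- A local ring is its own localization at the maximal ideal. -/
lemma isLocalization_atPrime_maximalIdeal (B : Type*) [CommRing B] [IsLocalRing B] :
    IsLocalization.AtPrime B (IsLocalRing.maximalIdeal B) := by
  refine IsLocalization.self fun x hx ↦ ?_
  rw [Ideal.mem_primeCompl_iff, IsLocalRing.mem_maximalIdeal] at hx
  exact not_not.1 hx

variable [IsNoetherianRing A]

/-- Strong `r`-regularity passes to the localizations at prime ideals. -/
theorem IsStronglyRRegular.localization {r : ℕ} (hA : IsStronglyRRegular A r)
    (p : Ideal A) [p.IsPrime] : IsStronglyRRegular (Localization.AtPrime p) r := by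
  rcases r with _ | r
  · exact isStronglyRRegular_zero_of_isField (hA.isField_localization p _)
  · obtain ⟨_, _⟩ :=
      hA.isDomain_and_isPrincipalIdealRing_localization p (Localization.AtPrime p)
    exact isStronglyRRegular_one_of_isPrincipalIdealRing.mono (Nat.le_add_left 1 r)

/-- The localizations of a noetherian ring at maximal ideals that are strongly `r`-regular for
some `r` are principal ideal domains. -/
lemma isDomain_and_isPrincipalIdealRing_of_isStronglyRegular (m : Ideal A) [m.IsMaximal]
    (h : IsStronglyRegular (Localization.AtPrime m)) :
    IsDomain (Localization.AtPrime m) ∧ IsPrincipalIdealRing (Localization.AtPrime m) := by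
  obtain ⟨r, hr⟩ := h
  have := isLocalization_atPrime_maximalIdeal (Localization.AtPrime m)
  have : IsNoetherianRing (Localization.AtPrime m) :=
    IsLocalization.isNoetherianRing m.primeCompl _ inferInstance
  exact hr.isDomain_and_isPrincipalIdealRing_localization (IsLocalRing.maximalIdeal _) _

/-- Strong `r`-regularity can be checked on the localizations at maximal ideals. -/
theorem isStronglyRRegular_of_localization {r : ℕ} (h : ∀ (m : Ideal A) [m.IsMaximal],
    IsStronglyRRegular (Localization.AtPrime m) r) : IsStronglyRRegular A r := by
  rcases r with _ | r
  · refine isStronglyRRegular_zero_of_localization fun m _ ↦ ?_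
    have := isLocalization_atPrime_maximalIdeal (Localization.AtPrime m)
    exact (h m).isField_localization (IsLocalRing.maximalIdeal _) _
  · exact (isStronglyRRegular_one_of_localization fun m _ ↦
      isDomain_and_isPrincipalIdealRing_of_isStronglyRegular m ⟨_, h m⟩).mono
        (Nat.le_add_left 1 r)

end

end StrongRegularity

theorem lemma1p8 (A : Type u) [CommRing A] [IsNoetherianRing A] :
    (∀ r : ℕ, List.TFAE [
      StrongRegularity.IsStronglyRRegular A r,
      ∀ (p : Ideal A) [p.IsPrime],
        StrongRegularity.IsStronglyRRegular (Localization.AtPrime p) r,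
      ∀ (m : Ideal A) [m.IsMaximal],
        StrongRegularity.IsStronglyRRegular (Localization.AtPrime m) r]) ∧
    List.TFAE [
      StrongRegularity.IsStronglyRegular A,
      ∀ (p : Ideal A) [p.IsPrime],
        StrongRegularity.IsStronglyRegular (Localization.AtPrime p),
      ∀ (m : Ideal A) [m.IsMaximal],
        StrongRegularity.IsStronglyRegular (Localization.AtPrime m)] := by
  refine ⟨fun r ↦ ?_, ?_⟩
  · tfae_have 1 → 2 := fun h p _ ↦ h.localization p
    tfae_have 2 → 3 := fun h m _ ↦ h m
    tfae_have 3 → 1 := fun h ↦ StrongRegularity.isStronglyRRegular_of_localization h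
    tfae_finish
  · tfae_have 1 → 2 := fun ⟨r, h⟩ p _ ↦ ⟨r, h.localization p⟩
    tfae_have 2 → 3 := fun h m _ ↦ h m
    -- The local bounds may be unbounded, but each only serves to make the local ring a principal
    -- ideal domain, so `1` works globally.
    tfae_have 3 → 1 := fun h ↦ ⟨1, StrongRegularity.isStronglyRRegular_one_of_localization
      fun m _ ↦ StrongRegularity.isDomain_and_isPrincipalIdealRing_of_isStronglyRegular m (h m)⟩
    tfae_finish
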